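/- Let $\tau$ be an infinite cardinal and let $G$ be an abelian group with $|G|\le 2^{2^\tau}$. Let $S\subseteq G$ be $\tau$-wide, that is, for every positive integer $n$ and every $S'\subseteq S$ with $|S'|<\tau$, the set $nS=\{ns:s\in S\}$ is not contained in the subgroup of $G$ generated by $S'$. Then there exists a precompact Hausdorff group topology $\mathscr{T}$ on $G$ such that $S$ is dense in $(G,\mathscr{T})$. Here a topological group is called precompact if it is isomorphic, as a topological group, to a subgroup of some compact Hausdorff group. -/

import Mathlib

universe u

/-- A subset `S` of an abelian group `G` is `τ`-wide (for an infinite cardinal `τ`) if, for every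
positive integer `n` and every `S' ⊆ S` with `|S'| < τ`, the set `nS = {n s : s ∈ S}` is not
contained in the subgroup generated by `S'`. -/
def IsWide {G : Type u} [AddCommGroup G] (τ : Cardinal.{u}) (S : Set G) : Prop :=
  ∀ n : ℕ, 0 < n → ∀ S' : Set G, S' ⊆ S → Cardinal.mk S' < τ →
    (((fun s : G => n • s) '' S) \ (AddSubgroup.closure S' : Set G)).Nonempty

/-- A topological group is precompact if it is isomorphic, as a topological group, to a subgroup
of some compact Hausdorff group. The ambient group need not be commutative. -/
def IsPrecompactAddGroup (G : Type u) [AddGroup G] [TopologicalSpace G] : Prop :=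
  ∃ (K : Type u) (_ : AddGroup K) (_ : TopologicalSpace K),
    IsTopologicalAddGroup K ∧ CompactSpace K ∧ T2Space K ∧
      ∃ H : AddSubgroup K, Nonempty (G ≃ₜ+ H)

/-!
The topology is induced by an injective homomorphism `φ` from `G` to the compact group `T ^ I` that
maps `S` onto a dense set, where `T` is the circle and `I = Set ι × Bool` with `ι` the initial
ordinal of `τ`, so that `#I = 2 ^ τ`. Its coordinates are characters `χ i : G → T`.

*Density.* By `exists_dense_seq_unitAddCircle_pow`, the Hewitt–Marczewski–Pondiczery theorem for the
circle, `T ^ I` has a dense set of `τ` points `t α`, indexed together with numbers `N α` such that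
the `t α` with `N α = n` come close to every point in finitely many coordinates, up to
`1 / (n + 1)`, for each `n`. Wideness gives, by recursion on `α`, elements `s α` of `S` whose
multiple by `(N α + 1)!` is not in the subgroup generated by the preceding ones
(`IsWide.exists_seq`). So `s α` has order larger than `N α + 1` modulo that subgroup, and a
character given on it extends to `s α` with a value within `1 / (N α + 1)` of any target, the circle
being injective. Hence for every `i` some character of `G` is close to `t α i` at `s α` for all `α`
simultaneously (`exists_addMonoidHom_approx`; compactness of the set of characters reduces this to
finitely many `α`), and any such choice of the `χ i` makes `φ '' S` dense.

*Injectivity.* Let `H` be the subgroup generated by the `s α`. Since `#H ≤ 2 ^ τ`, and since the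
values at the `s α` are only prescribed approximately, pairs `a (A, false)`, `a (A, true)` of such
characters can be chosen whose differences separate the points of `H`
(`exists_addMonoidHom_approx_apply_ne`). The common kernel `M` of the differences then meets `H`
trivially. Adding to both members of each pair a character `b A` that vanishes on `H` changes
neither the values at the `s α` nor the differences, and on `M` the `b A` are arbitrary. A family of
`2 ^ τ` characters that separates the points of `G`, which exists because `#G ≤ 2 ^ 2 ^ τ`
(`exists_separating_characters`), can therefore be reproduced on `M`. An element killed by all
characters `a (A, k) + b A` lies in `M`, so it is zero.
-/

open Set Cardinal

/-! ### Characters of an abelian group with values in the circle -/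

/-- The circle is divisible, hence injective: a homomorphism `g` into it factors through any
homomorphism `f` whose kernel is contained in that of `g`. -/
theorem exists_addMonoidHom_unitAddCircle_comp_eq {A B : Type*} [AddCommGroup A] [AddCommGroup B]
    (f : A →+ B) (g : A →+ UnitAddCircle) (h : ∀ a, f a = 0 → g a = 0) :
    ∃ c : B →+ UnitAddCircle, ∀ a, c (f a) = g a := by
  have hinj : Function.Injective (QuotientAddGroup.kerLift f) :=
    QuotientAddGroup.kerLift_injective f
  obtain ⟨c, hc⟩ := (Module.Baer.of_divisible UnitAddCircle).extension_property_addMonoidHom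
    (QuotientAddGroup.kerLift f) hinj (QuotientAddGroup.lift f.ker g fun a ha => h a ha)
  exact ⟨c, fun a => DFunLike.congr_fun hc (a : A ⧸ f.ker)⟩

/-- A character may be prescribed to vanish on a subgroup `K` and to take the value `u` at `x`,
as soon as `u` satisfies the relations that `x` satisfies modulo `K`. -/
theorem exists_addMonoidHom_unitAddCircle_vanishing {G : Type*} [AddCommGroup G]
    (K : AddSubgroup G) (x : G) (u : UnitAddCircle) (h : ∀ n : ℤ, n • x ∈ K → n • u = 0) :
    ∃ c : G →+ UnitAddCircle, (∀ k ∈ K, c k = 0) ∧ c x = u := by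
  obtain ⟨c, hc⟩ := exists_addMonoidHom_unitAddCircle_comp_eq
    (K.subtype.coprod (zmultiplesHom G x)) ((0 : K →+ UnitAddCircle).coprod
      (zmultiplesHom UnitAddCircle u)) (by
      rintro ⟨k, n⟩ hkn
      simp only [AddMonoidHom.coprod_apply, AddSubgroup.coe_subtype, zmultiplesHom_apply,
        AddMonoidHom.zero_apply, zero_add] at hkn ⊢
      refine h n ?_
      rw [eq_neg_of_add_eq_zero_right hkn]
      exact K.neg_mem k.2)
  refine ⟨c, fun k hk => ?_, ?_⟩
  · simpa using hc (⟨k, hk⟩, 0)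
  · simpa using hc (0, 1)

/-- The circle has elements of every order, `m = 0` standing for infinite order. -/
theorem exists_zsmul_eq_zero_iff_dvd (m : ℕ) :
    ∃ v : UnitAddCircle, ∀ n : ℤ, n • v = 0 ↔ (m : ℤ) ∣ n := by
  rcases Nat.eq_zero_or_pos m with rfl | hm
  · refine ⟨((√2 : ℝ) : UnitAddCircle), fun n => ?_⟩
    rw [Nat.cast_zero, zero_dvd_iff]
    refine ⟨fun h => ?_, fun h => by simp [h]⟩
    rw [← AddCircle.coe_zsmul, AddCircle.coe_eq_zero_iff] at h
    obtain ⟨k, hk⟩ := h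
    by_contra hn
    refine irrational_sqrt_two.intCast_mul hn ⟨(k : ℚ), ?_⟩
    simpa using hk
  · have : Fact ((0 : ℝ) < 1) := ⟨one_pos⟩
    refine ⟨((1 / m : ℝ) : UnitAddCircle), fun n => ?_⟩
    rw [← addOrderOf_dvd_iff_zsmul_eq_zero, AddCircle.addOrderOf_period_div hm]

/-- The multiples of `1 / m` form a `1 / m`-net of the circle. -/
theorem exists_int_div_norm_sub_le {m : ℕ} (hm : 0 < m) (t : UnitAddCircle) :
    ∃ z : ℤ, ‖((z / m : ℝ) : UnitAddCircle) - t‖ ≤ 1 / m := by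
  obtain ⟨r, rfl⟩ := QuotientAddGroup.mk_surjective t
  have hm' : (0 : ℝ) < m := by exact_mod_cast hm
  refine ⟨round (m * r), ?_⟩
  change ‖((round (m * r) / m : ℝ) : UnitAddCircle) - ((r : ℝ) : UnitAddCircle)‖ ≤ _
  rw [← AddCircle.coe_sub]
  refine (QuotientAddGroup.norm_mk_le_norm (S := AddSubgroup.zmultiples (1 : ℝ))).trans ?_
  rw [Real.norm_eq_abs]
  have h1 : (round (m * r) / m : ℝ) - r = (round (m * r) - m * r) / m := by field_simp
  rw [h1, abs_div, abs_of_pos hm', abs_sub_comm]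
  gcongr
  linarith [abs_sub_round (m * r : ℝ)]

/-- If the multiple of `x` by `(N + 1)!` is not in `K`, then the order `d` of `x` modulo `K` is
infinite (encoded as `d = 0`) or larger than `N + 1`. -/
theorem exists_zsmul_mem_iff_dvd {G : Type*} [AddCommGroup G] (K : AddSubgroup G) (x : G)
    (N : ℕ) (hx : (N + 1).factorial • x ∉ K) :
    ∃ d : ℕ, (∀ n : ℤ, n • x ∈ K ↔ (d : ℤ) ∣ n) ∧ (d = 0 ∨ N + 1 < d) := by
  have key : ∀ n : ℤ, n • x ∈ K ↔ (addOrderOf (x : G ⧸ K) : ℤ) ∣ n := fun n => by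
    rw [addOrderOf_dvd_iff_zsmul_eq_zero, ← QuotientAddGroup.mk_zsmul,
      QuotientAddGroup.eq_zero_iff]
  refine ⟨addOrderOf (x : G ⧸ K), key, ?_⟩
  by_contra! h
  apply hx
  have := (key ((N + 1).factorial : ℕ)).2
    (Int.natCast_dvd_natCast.2 (Nat.dvd_factorial (Nat.pos_of_ne_zero h.1) h.2))
  rwa [natCast_zsmul] at this

/-- If the multiple of `x` by `(N + 1)!` is not in `K`, the values at `x` of the characters
vanishing on `K` form a `1 / (N + 1)`-net. -/
theorem exists_addMonoidHom_norm_sub_le {G : Type*} [AddCommGroup G] (K : AddSubgroup G) (x : G)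
    (N : ℕ) (hx : (N + 1).factorial • x ∉ K) (t : UnitAddCircle) :
    ∃ c : G →+ UnitAddCircle, (∀ k ∈ K, c k = 0) ∧ ‖c x - t‖ ≤ 1 / (N + 1 : ℝ) := by
  obtain ⟨d, hd, hdN⟩ := exists_zsmul_mem_iff_dvd K x N hx
  obtain ⟨u, hu, hut⟩ : ∃ u : UnitAddCircle, d • u = 0 ∧ ‖u - t‖ ≤ 1 / (N + 1 : ℝ) := by
    rcases hdN with rfl | hdN
    · exact ⟨t, by simp, by rw [sub_self, norm_zero]; positivity⟩
    · have hd0 : (d : ℝ) ≠ 0 := by exact_mod_cast (by lia : d ≠ 0)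
      obtain ⟨z, hz⟩ := exists_int_div_norm_sub_le (by lia : 0 < d) t
      refine ⟨((z / d : ℝ) : UnitAddCircle), ?_, hz.trans ?_⟩
      · rw [← AddCircle.coe_nsmul, AddCircle.coe_eq_zero_iff]
        exact ⟨z, by rw [zsmul_eq_mul, mul_one, nsmul_eq_mul, mul_div_cancel₀ _ hd0]⟩
      · gcongr
        exact_mod_cast hdN.le
  obtain ⟨c, hcK, hcx⟩ := exists_addMonoidHom_unitAddCircle_vanishing K x u fun n hn => by
    obtain ⟨m, rfl⟩ := (hd n).1 hn
    rw [mul_comm, mul_zsmul, natCast_zsmul, hu, smul_zero]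
  exact ⟨c, hcK, hcx ▸ hut⟩

/-- Under the same condition on `x`, any multiple of `x` outside `K` is detected by a character
that vanishes on `K` and is small at `x`. -/
theorem exists_addMonoidHom_norm_le_of_zsmul_notMem {G : Type*} [AddCommGroup G]
    (K : AddSubgroup G) (x : G) (N : ℕ) (hx : (N + 1).factorial • x ∉ K) (k : ℤ)
    (hk : k • x ∉ K) :
    ∃ c : G →+ UnitAddCircle, (∀ y ∈ K, c y = 0) ∧ ‖c x‖ ≤ 1 / (N + 1 : ℝ) ∧ k • c x ≠ 0 := by
  obtain ⟨d, hd, hdN⟩ := exists_zsmul_mem_iff_dvd K x N hx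
  -- The value at `x` is `1 / m`, where `m` is the order of `x` modulo `K` if that is finite, and
  -- otherwise just large enough for `1 / m` to be small and not to be killed by `k`.
  obtain ⟨m, hdm, hkm, hNm⟩ : ∃ m : ℕ, m ∣ d ∧ ¬ (m : ℤ) ∣ k ∧ N + 1 ≤ m := by
    rcases hdN with rfl | hdN
    · have hk0 : k ≠ 0 := by rintro rfl; simp at hk
      refine ⟨k.natAbs + 1 + N, dvd_zero _, fun h => ?_, ?_⟩
      · have := Nat.le_of_dvd (Int.natAbs_pos.2 hk0) (Int.natCast_dvd.1 h)
        lia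
      · have := Int.natAbs_pos.2 hk0
        lia
    · exact ⟨d, dvd_rfl, fun h => hk ((hd k).2 h), hdN.le⟩
  have : Fact ((0 : ℝ) < 1) := ⟨one_pos⟩
  have hu : ∀ n : ℤ, n • ((1 / m : ℝ) : UnitAddCircle) = 0 ↔ (m : ℤ) ∣ n := fun n => by
    rw [← addOrderOf_dvd_iff_zsmul_eq_zero, AddCircle.addOrderOf_period_div (by lia)]
  obtain ⟨c, hcK, hcx⟩ := exists_addMonoidHom_unitAddCircle_vanishing K x
    ((1 / m : ℝ) : UnitAddCircle) fun n hn =>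
      (hu n).2 ((Int.natCast_dvd_natCast.2 hdm).trans ((hd n).1 hn))
  refine ⟨c, hcK, ?_, ?_⟩
  · rw [hcx]
    refine (QuotientAddGroup.norm_mk_le_norm (S := AddSubgroup.zmultiples (1 : ℝ))).trans ?_
    rw [Real.norm_eq_abs, abs_of_nonneg (by positivity)]
    gcongr
    exact_mod_cast hNm
  · rwa [hcx, Ne, hu]

/-! ### Separating the points of a large group by few characters -/

open Classical in
/-- Finitely many sets are told apart by their traces on a suitable finite set. -/
theorem exists_finset_injOn_filter_mem {κ : Type*} {𝒜 : Set (Set κ)} (h𝒜 : 𝒜.Finite) :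
    ∃ F : Finset κ, InjOn (fun A : Set κ => F.filter (· ∈ A)) 𝒜 := by
  have key : ∀ p : Set κ × Set κ, ∃ F : Finset κ,
      p.1 ≠ p.2 → ∃ x ∈ F, ¬ (x ∈ p.1 ↔ x ∈ p.2) := fun p => by
    by_cases h : p.1 = p.2
    · exact ⟨∅, fun h' => absurd h h'⟩
    · obtain ⟨x, hx⟩ := not_forall.1 (mt Set.ext h)
      exact ⟨{x}, fun _ => ⟨x, by simp, hx⟩⟩
  choose F hF using key
  refine ⟨(h𝒜.prod h𝒜).toFinset.biUnion F, fun A hA B hB hAB => ?_⟩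
  by_contra hne
  obtain ⟨x, hxF, hx⟩ := hF (A, B) hne
  refine hx ?_
  have hmem : x ∈ (h𝒜.prod h𝒜).toFinset.biUnion F :=
    Finset.mem_biUnion.2 ⟨(A, B), (h𝒜.prod h𝒜).mem_toFinset.2 ⟨hA, hB⟩, hxF⟩
  have := Finset.ext_iff.1 hAB x
  simpa only [Finset.mem_filter, hmem, true_and] using this

/-- A set `X` of elements of an abelian group is independent if the sum of the cyclic subgroups
generated by its elements is direct. Unlike linear independence over `ℤ`, this allows for elements
of finite order. -/
def IsCyclicIndep {G : Type*} [AddCommGroup G] (X : Set G) : Prop :=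
  ∀ f ∈ Finsupp.supported ℤ ℤ X, Finsupp.linearCombination ℤ (id : G → G) f = 0 →
    ∀ x, f x • x = 0

/-- The subgroup generated by a maximal independent set is essential: it meets every nontrivial
cyclic subgroup. -/
theorem exists_isCyclicIndep_essential (G : Type*) [AddCommGroup G] :
    ∃ X : Set G, IsCyclicIndep X ∧ ∀ g : G, g ≠ 0 → ∃ n : ℤ, n • g ≠ 0 ∧
      ∃ f ∈ Finsupp.supported ℤ ℤ X, Finsupp.linearCombination ℤ (id : G → G) f = n • g := by
  obtain ⟨X, hX⟩ := zorn_subset {X : Set G | IsCyclicIndep X} fun c hc hchain => by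
    rcases c.eq_empty_or_nonempty with rfl | hne
    · refine ⟨∅, fun f hf _ x => ?_, by simp⟩
      rw [Finsupp.supported_empty, Submodule.mem_bot] at hf
      simp [hf]
    · refine ⟨⋃₀ c, fun f hf hf0 => ?_, fun s hs => subset_sUnion_of_mem hs⟩
      obtain ⟨t, htc, hft⟩ := hchain.directedOn.exists_mem_subset_of_finset_subset_biUnion hne
        (f := id) (s := f.support)
        (by simpa [sUnion_eq_biUnion] using (Finsupp.mem_supported _ _).1 hf)
      exact hc htc f ((Finsupp.mem_supported _ _).2 hft) hf0
  have hind : IsCyclicIndep X := hX.prop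
  refine ⟨X, hind, fun g hg => ?_⟩
  by_contra! hcon
  -- Otherwise `insert g X` is independent too, whence `g ∈ X` by maximality.
  have hins : IsCyclicIndep (insert g X) := fun f hf hf0 => by
    classical
    have hsupp : f.erase g ∈ Finsupp.supported ℤ ℤ X := by
      rw [Finsupp.mem_supported] at hf ⊢
      intro x hx
      rw [Finsupp.support_erase, Finset.coe_erase] at hx
      exact (hf hx.1).resolve_left hx.2
    have hsum : f g • g + Finsupp.linearCombination ℤ (id : G → G) (f.erase g) = 0 := by
      rw [← hf0]
      conv_rhs => rw [← Finsupp.single_add_erase g f, map_add, Finsupp.linearCombination_single]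
      rfl
    have hfg : f g • g = 0 := by
      by_contra hne
      refine hcon _ hne (-(f.erase g)) (Submodule.neg_mem _ hsupp) ?_
      rw [map_neg, eq_comm]
      exact eq_neg_of_add_eq_zero_left hsum
    rw [hfg, zero_add] at hsum
    intro x
    by_cases hxg : x = g
    · rwa [hxg]
    · simpa [Finsupp.erase_ne hxg] using hind _ hsupp hsum x
  have hgX : g ∈ X := hX.le_of_ge hins (subset_insert g X) (mem_insert g X)
  exact hcon 1 (by simpa using hg) (Finsupp.single g 1) (Finsupp.single_mem_supported ℤ 1 hgX)
    (by simp)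

open Classical in
/-- An abelian group `G` of cardinality at most `2 ^ #κ` has a point-separating family of
characters indexed by pairs of finite subsets of `κ`. On a maximal independent set, whose
elements are labelled injectively by subsets of `κ`, the character with index `(F, A)` is faithful
on the cyclic subgroups generated by the elements whose label has trace `A` on `F`, and trivial on
the others. -/
theorem exists_separating_characters {G κ : Type u} [AddCommGroup G] (hG : #G ≤ #(Set κ)) :
    ∃ e : Finset κ × Finset κ → G →+ UnitAddCircle, ∀ g, (∀ i, e i g = 0) → g = 0 := by
  obtain ⟨⟨j, hj⟩⟩ := hG
  obtain ⟨X, hX, hess⟩ := exists_isCyclicIndep_essential G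
  have hv : ∀ x : G, ∃ v : UnitAddCircle, ∀ n : ℤ, n • v = 0 ↔ n • x = 0 := fun x => by
    obtain ⟨v, hv⟩ := exists_zsmul_eq_zero_iff_dvd (addOrderOf x)
    exact ⟨v, fun n => by rw [hv, addOrderOf_dvd_iff_zsmul_eq_zero]⟩
  choose v hv using hv
  let w (i : Finset κ × Finset κ) (x : G) : UnitAddCircle :=
    if i.1.filter (· ∈ j x) = i.2 then v x else 0
  have he : ∀ i, ∃ e : G →+ UnitAddCircle, ∀ f ∈ Finsupp.supported ℤ ℤ X,
      e (Finsupp.linearCombination ℤ (id : G → G) f) = Finsupp.linearCombination ℤ (w i) f := by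
    intro i
    obtain ⟨e, he⟩ := exists_addMonoidHom_unitAddCircle_comp_eq
      ((Finsupp.linearCombination ℤ (id : G → G)).comp
        (Finsupp.supported ℤ ℤ X).subtype).toAddMonoidHom
      ((Finsupp.linearCombination ℤ (w i)).comp
        (Finsupp.supported ℤ ℤ X).subtype).toAddMonoidHom (by
          rintro ⟨f, hf⟩ hf0
          change Finsupp.linearCombination ℤ (w i) f = 0
          rw [Finsupp.linearCombination_apply]
          refine Finset.sum_eq_zero fun x _ => ?_
          dsimp only [w]
          split_ifs
          · exact (hv x _).2 (hX f hf hf0 x)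
          · exact smul_zero _)
    exact ⟨e, fun f hf => he ⟨f, hf⟩⟩
  choose e he using he
  refine ⟨e, fun g hg => ?_⟩
  by_contra hg0
  obtain ⟨n, hng, f, hf, hfg⟩ := hess g hg0
  obtain ⟨x, hx⟩ : ∃ x, f x • x ≠ 0 := by
    by_contra! h
    apply hng
    rw [← hfg, Finsupp.linearCombination_apply]
    exact Finset.sum_eq_zero fun x _ => h x
  have hxf : x ∈ f.support := Finsupp.mem_support_iff.2 fun h => hx (by simp [h])
  obtain ⟨F, hF⟩ := exists_finset_injOn_filter_mem ((f.support.finite_toSet).image j)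
  -- The chosen index isolates the summand at `x`.
  refine (mt (hv x (f x)).1 hx) ?_
  have h1 : e (F, F.filter (· ∈ j x)) (n • g) = 0 := by rw [map_zsmul, hg, smul_zero]
  rw [← hfg, he _ f hf, Finsupp.linearCombination_apply, Finsupp.sum,
    Finset.sum_eq_single_of_mem x hxf] at h1
  · simpa [w] using h1
  · intro y hy hyx
    dsimp only [w]
    rw [if_neg, smul_zero]
    exact fun h => hyx (hj (hF (mem_image_of_mem j hy) (mem_image_of_mem j hxf) h))

/-! ### Characters with approximately prescribed values on a transfinite sequence -/

/-- A `τ`-wide set contains a sequence of length `τ` whose members are, with arbitrarily prescribed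
multipliers `m α`, independent of the preceding ones. -/
theorem IsWide.exists_seq {G ι : Type u} [AddCommGroup G] [LinearOrder ι] [WellFoundedLT ι]
    {τ : Cardinal.{u}} (hι : ∀ α : ι, #(Iio α) < τ) {S : Set G} (hS : IsWide τ S) (m : ι → ℕ)
    (hm : ∀ α, 0 < m α) :
    ∃ s : ι → G, (∀ α, s α ∈ S) ∧ ∀ α, m α • s α ∉ AddSubgroup.closure (s '' Iio α) := by
  have key : ∀ (α : ι) (prev : ∀ β, β < α → S), ∃ x : S,
      m α • (x : G) ∉ AddSubgroup.closure (range fun β : Iio α => (prev β.1 β.2 : G)) := by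
    intro α prev
    obtain ⟨_, ⟨⟨x, hxS, rfl⟩, hx⟩⟩ := hS (m α) (hm α)
      (range fun β : Iio α => (prev β.1 β.2 : G)) (by rintro _ ⟨β, rfl⟩; exact (prev β.1 β.2).2)
      (mk_range_le.trans_lt (hι α))
    exact ⟨⟨x, hxS⟩, hx⟩
  choose next hnext using key
  obtain ⟨s, hs⟩ : ∃ s : ι → S, ∀ α, s α = next α fun β _ => s β :=
    ⟨wellFounded_lt.fix next, wellFounded_lt.fix_eq next⟩
  refine ⟨fun α => s α, fun α => (s α).2, fun α => ?_⟩
  have h := hnext α fun β _ => s β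
  rwa [← hs, ← image_eq_range (fun β => (s β : G))] at h

/-- If each `s α` has large order modulo the preceding ones, there is a character with
approximately prescribed values at all the `s α`. The values on an initial segment `L` may be
prescribed exactly, by a given character. -/
theorem exists_addMonoidHom_approx {G ι : Type*} [AddCommGroup G] [LinearOrder ι] {s : ι → G}
    {N : ι → ℕ} (hs : ∀ α, (N α + 1).factorial • s α ∉ AddSubgroup.closure (s '' Iio α))
    {L : Set ι} (hL : IsLowerSet L) (a₀ : G →+ UnitAddCircle) (t : ι → UnitAddCircle) :
    ∃ a : G →+ UnitAddCircle, (∀ α ∈ L, a (s α) = a₀ (s α)) ∧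
      ∀ α ∉ L, ‖a (s α) - t α‖ ≤ 1 / (N α + 1 : ℝ) := by
  have hfin : ∀ u : Finset ι, ∃ a : G →+ UnitAddCircle, (∀ α ∈ L, a (s α) = a₀ (s α)) ∧
      ∀ α ∈ u, α ∉ L → ‖a (s α) - t α‖ ≤ 1 / (N α + 1 : ℝ) := by
    intro u
    induction u using Finset.induction_on_max with
    | empty => exact ⟨a₀, fun _ _ => rfl, by simp⟩
    | insert γ u hu ih =>
      obtain ⟨a, haL, hau⟩ := ih
      by_cases hγ : γ ∈ L
      · refine ⟨a, haL, fun α hα hαL => ?_⟩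
        rcases Finset.mem_insert.1 hα with rfl | hα
        exacts [absurd hγ hαL, hau α hα hαL]
      · obtain ⟨c, hcK, hc⟩ := exists_addMonoidHom_norm_sub_le _ _ _ (hs γ) (t γ - a (s γ))
        have hlt : ∀ α < γ, c (s α) = 0 := fun α hα =>
          hcK _ (AddSubgroup.subset_closure (mem_image_of_mem s hα))
        refine ⟨a + c, fun α hα => ?_, fun α hα hαL => ?_⟩
        · have hαγ : α < γ := lt_of_not_ge fun h => hγ (hL h hα)
          rw [AddMonoidHom.add_apply, hlt α hαγ, add_zero, haL α hα]
        · rcases Finset.mem_insert.1 hα with rfl | hα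
          · rwa [AddMonoidHom.add_apply, show a (s α) + c (s α) - t α =
              c (s α) - (t α - a (s α)) by abel]
          · rw [AddMonoidHom.add_apply, hlt α (hu α hα), add_zero]
            exact hau α hα hαL
  -- The characters form a compact subset of `G → UnitAddCircle`, and the conditions are closed.
  let Z : Set (G → UnitAddCircle) :=
    range ((↑) : (G →+ UnitAddCircle) → G → UnitAddCircle) ∩ {a | ∀ α ∈ L, a (s α) = a₀ (s α)}
  have hZ : IsCompact Z := by
    refine (IsClosed.inter (AddMonoidHom.isClosed_range_coe _ _) ?_).isCompact
    simp only [ofPred_forall]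
    exact isClosed_biInter fun α _ => isClosed_eq (continuous_apply _) continuous_const
  obtain ⟨_, ⟨⟨a, rfl⟩, haL⟩, ha⟩ := hZ.inter_iInter_nonempty
    (fun α : ι => {a | α ∉ L → ‖a (s α) - t α‖ ≤ 1 / (N α + 1 : ℝ)}) (fun α => by
      by_cases hα : α ∈ L
      · simp [hα]
      · simp only [hα, not_false_eq_true, forall_const]
        exact isClosed_le (by fun_prop) continuous_const) (fun u => by
      obtain ⟨a, haL, hau⟩ := hfin u
      exact ⟨a, ⟨⟨a, rfl⟩, haL⟩, mem_iInter₂.2 hau⟩)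
  exact ⟨a, haL, fun α => mem_iInter.1 ha α⟩

theorem AddSubgroup.eq_zero_or_exists_mem_closure_image_Iic {G ι : Type*} [AddCommGroup G]
    [LinearOrder ι] (s : ι → G) (L : Set ι) {h : G} (hh : h ∈ AddSubgroup.closure (s '' L)) :
    h = 0 ∨ ∃ β ∈ L, h ∈ AddSubgroup.closure (s '' Iic β) := by
  induction hh using AddSubgroup.closure_induction with
  | mem x hx =>
    obtain ⟨β, hβ, rfl⟩ := hx
    exact .inr ⟨β, hβ, AddSubgroup.subset_closure (mem_image_of_mem s (mem_Iic.2 le_rfl))⟩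
  | zero => exact .inl rfl
  | add x y _ _ hx hy =>
    rcases hx with rfl | ⟨β, hβ, hx⟩
    · simpa using hy
    rcases hy with rfl | ⟨γ, hγ, hy⟩
    · exact .inr ⟨β, hβ, by simpa using hx⟩
    have mono : ∀ {β δ : ι}, β ≤ δ →
        AddSubgroup.closure (s '' Iic β) ≤ AddSubgroup.closure (s '' Iic δ) := fun h =>
      AddSubgroup.closure_mono (image_mono (Iic_subset_Iic.2 h))
    rcases le_total β γ with h | h
    · exact .inr ⟨γ, hγ, add_mem (mono h hx) hy⟩
    · exact .inr ⟨β, hβ, add_mem hx (mono h hy)⟩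
  | neg x _ hx =>
    rcases hx with rfl | ⟨β, hβ, hx⟩
    · simp
    · exact .inr ⟨β, hβ, neg_mem hx⟩

/-- A nonzero element of the subgroup generated by a well-ordered sequence has a leading term. -/
theorem AddSubgroup.exists_leading_term {G ι : Type*} [AddCommGroup G]
    [LinearOrder ι] [WellFoundedLT ι] (s : ι → G) {h : G}
    (hh : h ∈ AddSubgroup.closure (range s)) (h0 : h ≠ 0) :
    ∃ (α : ι) (k : ℤ), ∃ y ∈ AddSubgroup.closure (s '' Iio α), h = y + k • s α ∧
      k • s α ∉ AddSubgroup.closure (s '' Iio α) := by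
  rw [← image_univ] at hh
  have hne : {β | h ∈ AddSubgroup.closure (s '' Iic β)}.Nonempty := by
    obtain ⟨β, -, hβ⟩ :=
      (AddSubgroup.eq_zero_or_exists_mem_closure_image_Iic s univ hh).resolve_left h0
    exact ⟨β, hβ⟩
  obtain ⟨α, hα, hmin⟩ := wellFounded_lt.has_min _ hne
  have hα' : h ∈ AddSubgroup.closure (s '' Iio α) ⊔ AddSubgroup.zmultiples (s α) := by
    rw [AddSubgroup.zmultiples_eq_closure, ← AddSubgroup.closure_union, ← image_singleton,
      ← image_union, Iio_union_right]
    exact hα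
  obtain ⟨y, hy, _, ⟨k, rfl⟩, rfl⟩ := AddSubgroup.mem_sup.1 hα'
  refine ⟨α, k, y, hy, rfl, fun hk => ?_⟩
  obtain ⟨β, hβ, hβ'⟩ := (AddSubgroup.eq_zero_or_exists_mem_closure_image_Iic s _
    (add_mem hy hk)).resolve_left h0
  exact hmin β hβ' hβ

/-- The approximation leaves enough freedom to avoid a given value at a given nonzero element of
the subgroup generated by the sequence: the character may be altered at the leading term. -/
theorem exists_addMonoidHom_approx_apply_ne {G ι : Type*} [AddCommGroup G] [LinearOrder ι]
    [WellFoundedLT ι] {s : ι → G} {N : ι → ℕ}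
    (hs : ∀ α, (N α + 1).factorial • s α ∉ AddSubgroup.closure (s '' Iio α))
    (t : ι → UnitAddCircle) {h : G} (hh : h ∈ AddSubgroup.closure (range s)) (h0 : h ≠ 0)
    (c : UnitAddCircle) :
    ∃ a : G →+ UnitAddCircle, (∀ α, ‖a (s α) - t α‖ ≤ 2 / (N α + 1 : ℝ)) ∧ a h ≠ c := by
  have hle : ∀ n : ℕ, 1 / (n + 1 : ℝ) ≤ 2 / (n + 1 : ℝ) := fun n => by gcongr; norm_num
  obtain ⟨a, -, ha⟩ := exists_addMonoidHom_approx hs isLowerSet_empty 0 t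
  by_cases hac : a h = c
  swap
  · exact ⟨a, fun α => (ha α (notMem_empty α)).trans (hle _), hac⟩
  obtain ⟨α, k, y, hy, rfl, hk⟩ := AddSubgroup.exists_leading_term s hh h0
  obtain ⟨d, hdK, hd, hkd⟩ := exists_addMonoidHom_norm_le_of_zsmul_notMem _ _ _ (hs α) k hk
  obtain ⟨b, hbL, hb⟩ := exists_addMonoidHom_approx hs (isLowerSet_Iic α) (a + d) t
  have hlt : ∀ β < α, d (s β) = 0 := fun β hβ =>
    hdK _ (AddSubgroup.subset_closure (mem_image_of_mem s hβ))
  refine ⟨b, fun β => ?_, ?_⟩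
  · rcases lt_trichotomy β α with hβ | rfl | hβ
    · rw [hbL β hβ.le, AddMonoidHom.add_apply, hlt β hβ, add_zero]
      exact (ha β (notMem_empty β)).trans (hle _)
    · rw [hbL β (mem_Iic.2 le_rfl), AddMonoidHom.add_apply, add_sub_right_comm]
      refine (norm_add_le _ _).trans ((add_le_add (ha β (notMem_empty β)) hd).trans_eq ?_)
      ring
    · exact (hb β (notMem_Iic.2 hβ)).trans (hle _)
  · have hby : b y = a y := by
      have : AddSubgroup.closure (s '' Iio α) ≤ b.eqLocus a := by
        rw [AddSubgroup.closure_le]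
        rintro _ ⟨β, hβ, rfl⟩
        change b (s β) = a (s β)
        rw [hbL β (mem_Iio.1 hβ).le, AddMonoidHom.add_apply, hlt β hβ, add_zero]
      exact this hy
    rw [← hac, map_add, map_add, map_zsmul, map_zsmul, hbL α (mem_Iic.2 le_rfl), hby,
      AddMonoidHom.add_apply, smul_add]
    simpa using hkd

/-! ### A point-separating family of characters that is dense on the sequence -/

open Classical in
/-- The power `UnitAddCircle ^ (2 ^ #ι)` has a dense subset of cardinality `#ι`, in the form of a
sequence `t` of points that approximate every point in any finitely many coordinates, with
prescribed accuracy. The point with label `(F, w, n)` has at `(A, k)` the coordinate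
`w (F ∩ A, k) / (n + 1)`. -/
theorem exists_dense_seq_unitAddCircle_pow (ι : Type u) [Infinite ι] :
    ∃ (N : ι → ℕ) (t : ι → Set ι × Bool → UnitAddCircle),
      ∀ (J : Finset (Set ι × Bool)) (y : Set ι × Bool → UnitAddCircle) (n : ℕ),
        ∃ α, N α = n ∧ ∀ j ∈ J, ‖t α j - y j‖ ≤ 1 / (n + 1 : ℝ) := by
  have hcard : #(Finset ι × (Finset ι × Bool →₀ ℤ) × ℕ) ≤ #ι := by
    have h := aleph0_le_mk ι
    have h2 : #ι * 2 = #ι := mul_eq_left h (ofNat_lt_aleph0.le.trans h) two_ne_zero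
    simp [h2, h, mul_eq_self h]
  obtain ⟨⟨f, hf⟩⟩ := hcard
  obtain ⟨p, hp⟩ : ∃ p : ι → Finset ι × (Finset ι × Bool →₀ ℤ) × ℕ, Function.Surjective p :=
    ⟨Function.invFun f, Function.invFun_surjective hf⟩
  refine ⟨fun α => (p α).2.2, fun α j => (((p α).2.1 ((p α).1.filter (· ∈ j.1), j.2) /
    ((p α).2.2 + 1 : ℕ) : ℝ) : UnitAddCircle), fun J y n => ?_⟩
  obtain ⟨F, hF⟩ := exists_finset_injOn_filter_mem ((J.finite_toSet).image Prod.fst)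
  have hinj : InjOn (fun j : Set ι × Bool => (F.filter (· ∈ j.1), j.2)) J := by
    intro i hi j hj hij
    obtain ⟨h1, h2⟩ := Prod.mk.inj hij
    exact Prod.ext (hF (mem_image_of_mem _ hi) (mem_image_of_mem _ hj) h1) h2
  have hz : ∀ j, ∃ z : ℤ, ‖((z / (n + 1 : ℕ) : ℝ) : UnitAddCircle) - y j‖ ≤ 1 / (n + 1 : ℕ) :=
    fun j => exists_int_div_norm_sub_le n.succ_pos (y j)
  choose z hz using hz
  obtain ⟨α, hα⟩ := hp (F, Finsupp.mapDomain (fun j : Set ι × Bool => (F.filter (· ∈ j.1), j.2))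
    (Finsupp.indicator J fun j _ => z j), n)
  refine ⟨α, by simp only [hα], fun j hj => ?_⟩
  simp only [hα]
  rw [Finsupp.mapDomain_apply' J _ (by exact_mod_cast Finsupp.support_indicator_subset J _) hinj hj,
    Finsupp.indicator_of_mem hj]
  exact_mod_cast hz j

/-- The characters are `a (A, k) + b A`, where the `a (A, k)` have the prescribed approximate
values and the `b A` vanish on the subgroup `H` generated by the sequence. As there are at least as
many indices `A` as elements of `H`, the differences `a (A, true) - a (A, false)` can be made to
separate the points of `H`. Their common kernel `M` then meets `H` trivially, so that the `b A`
may be chosen to correct the restrictions to `M` of the `a (A, false)` arbitrarily. -/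
theorem exists_separating_characters_approx {G ι : Type u} [AddCommGroup G] [LinearOrder ι]
    [WellFoundedLT ι] [Infinite ι] (hG : #G ≤ #(Set (Set ι))) {s : ι → G} {N : ι → ℕ}
    (hs : ∀ α, (N α + 1).factorial • s α ∉ AddSubgroup.closure (s '' Iio α))
    (t : ι → Set ι × Bool → UnitAddCircle) :
    ∃ χ : Set ι × Bool → G →+ UnitAddCircle,
      (∀ i α, ‖χ i (s α) - t α i‖ ≤ 2 / (N α + 1 : ℝ)) ∧ ∀ g, (∀ i, χ i g = 0) → g = 0 := by
  let H : AddSubgroup G := AddSubgroup.closure (range s)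
  obtain ⟨e', he'⟩ := exists_separating_characters hG
  obtain ⟨e, he⟩ : ∃ e : Set ι → G →+ UnitAddCircle, ∀ g, (∀ A, e A g = 0) → g = 0 := by
    have hcard : #(Finset (Set ι) × Finset (Set ι)) ≤ #(Set ι) := by
      simpa using (mul_eq_self (aleph0_le_mk (Set ι))).le
    obtain ⟨⟨f, hf⟩⟩ := hcard
    refine ⟨fun A => e' (Function.invFun f A), fun g hg => he' g fun i => ?_⟩
    simpa [Function.leftInverse_invFun hf i] using hg (f i)
  obtain ⟨h, hh⟩ : ∃ h : Set ι → H, Function.Surjective h := by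
    have hcard : #H ≤ #(Set ι) := by
      have hrep : ∀ g : H, ∃ x : ι →₀ ℤ, (x.sum fun α n => n • s α) = g := fun g => by
        rw [← Finsupp.mem_span_range_iff_exists_finsupp, ← Submodule.mem_toAddSubgroup,
          Submodule.span_int_eq_addSubgroupClosure]
        exact g.2
      choose x hx using hrep
      calc #H ≤ #(ι →₀ ℤ) := mk_le_of_injective (f := x) fun g g' hgg' => by
              rw [Subtype.ext_iff, ← hx, ← hx, hgg']
        _ ≤ #(Set ι) := by simpa using (cantor #ι).le
    obtain ⟨⟨f, hf⟩⟩ := hcard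
    exact ⟨Function.invFun f, Function.invFun_surjective hf⟩
  have ha₀ : ∀ A : Set ι, ∃ a : G →+ UnitAddCircle,
      ∀ α, ‖a (s α) - t α (A, false)‖ ≤ 2 / (N α + 1 : ℝ) := fun A => by
    obtain ⟨a, -, ha⟩ := exists_addMonoidHom_approx hs isLowerSet_empty 0 fun α => t α (A, false)
    refine ⟨a, fun α => (ha α (notMem_empty α)).trans ?_⟩
    gcongr
    norm_num
  choose a₀ ha₀ using ha₀
  have ha₁ : ∀ A : Set ι, ∃ a : G →+ UnitAddCircle,
      (∀ α, ‖a (s α) - t α (A, true)‖ ≤ 2 / (N α + 1 : ℝ)) ∧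
        ((h A : G) ≠ 0 → a (h A) ≠ a₀ A (h A)) := fun A => by
    by_cases h0 : (h A : G) = 0
    · obtain ⟨a, -, ha⟩ := exists_addMonoidHom_approx hs isLowerSet_empty 0 fun α => t α (A, true)
      refine ⟨a, fun α => (ha α (notMem_empty α)).trans ?_, fun h' => absurd h0 h'⟩
      gcongr
      norm_num
    · obtain ⟨a, ha, hne⟩ := exists_addMonoidHom_approx_apply_ne hs (fun α => t α (A, true))
        (h A).2 h0 (a₀ A (h A))
      exact ⟨a, ha, fun _ => hne⟩
  choose a₁ ha₁ hne using ha₁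
  let M : AddSubgroup G := ⨅ A, (a₁ A - a₀ A).ker
  have hM : ∀ g, g ∈ M ↔ ∀ A, a₁ A g = a₀ A g := fun g => by
    simp [M, AddSubgroup.mem_iInf, AddMonoidHom.mem_ker, sub_eq_zero]
  have hMH : ∀ g ∈ M, g ∈ H → g = 0 := fun g hgM hgH => by
    obtain ⟨A, hA⟩ := hh ⟨g, hgH⟩
    by_contra hg0
    have hAg : (h A : G) = g := by rw [hA]
    exact hne A (by rwa [hAg]) (by rw [hAg]; exact (hM g).1 hgM A)
  have hb : ∀ A, ∃ b : G →+ UnitAddCircle, (∀ g ∈ H, b g = 0) ∧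
      ∀ g ∈ M, b g = e A g - a₀ A g := fun A => by
    obtain ⟨b, hb⟩ := exists_addMonoidHom_unitAddCircle_comp_eq (H.subtype.coprod M.subtype)
      ((0 : H →+ UnitAddCircle).coprod ((e A - a₀ A).comp M.subtype)) (by
        rintro ⟨x, y⟩ hxy
        have hxy' : (x : G) + y = 0 := hxy
        have hy : (y : G) = 0 := hMH y y.2 (by
          rw [eq_neg_of_add_eq_zero_right hxy']
          exact H.neg_mem x.2)
        simp [hy])
    refine ⟨b, fun g hg => ?_, fun g hg => ?_⟩
    · simpa using hb (⟨g, hg⟩, 0)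
    · simpa using hb (0, ⟨g, hg⟩)
  choose b hbH hbM using hb
  have hbs : ∀ A α, b A (s α) = 0 := fun A α =>
    hbH A _ (AddSubgroup.subset_closure (mem_range_self α))
  refine ⟨fun i => (bif i.2 then a₁ i.1 else a₀ i.1) + b i.1, ?_, fun g hg => ?_⟩
  · rintro ⟨A, _ | _⟩ α
    · simpa [hbs] using ha₀ A α
    · simpa [hbs] using ha₁ A α
  · have h0 : ∀ A, a₀ A g + b A g = 0 := fun A => hg (A, false)
    have h1 : ∀ A, a₁ A g + b A g = 0 := fun A => hg (A, true)
    have hgM : g ∈ M := (hM g).2 fun A => add_right_cancel ((h1 A).trans (h0 A).symm)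
    refine he g fun A => ?_
    have := h0 A
    rwa [hbM A g hgM, add_sub_cancel] at this

/-! ### Precompact topologies induced by homomorphisms -/

/-- The topology induced on `G` by an embedding into a compact group is precompact, and a set is
dense in it as soon as its image is dense in the compact group. -/
theorem exists_precompact_topology_of_injective {G K : Type u} [AddCommGroup G] [AddCommGroup K]
    [TopologicalSpace K] [IsTopologicalAddGroup K] [CompactSpace K] [T2Space K] (φ : G →+ K)
    (hφ : Function.Injective φ) {S : Set G} (hS : Dense (φ '' S)) :
    ∃ _ : TopologicalSpace G,
      IsTopologicalAddGroup G ∧ T2Space G ∧ IsPrecompactAddGroup G ∧ Dense S := by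
  let _ : TopologicalSpace G := TopologicalSpace.induced φ inferInstance
  have hind : Topology.IsInducing φ := ⟨rfl⟩
  have hemb : Topology.IsEmbedding φ := ⟨hind, hφ⟩
  refine ⟨inferInstance, hind.topologicalAddGroup φ, hemb.t2Space, ⟨K, inferInstance,
    inferInstance, inferInstance, inferInstance, inferInstance, φ.range, ⟨?_⟩⟩, ?_⟩
  · exact
      { AddMonoidHom.ofInjective hφ with
        continuous_toFun := hind.continuous.subtype_mk _
        continuous_invFun := hind.continuous_iff.2 (continuous_subtype_val.congr fun y =>
          congrArg Subtype.val ((AddMonoidHom.ofInjective hφ).apply_symm_apply y).symm) }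
  · intro g
    rw [hind.closure_eq_preimage_closure_image]
    exact hS (φ g)

/-! ### The dense embedding -/

theorem mainTheorem5 {G : Type u} [AddCommGroup G] (τ : Cardinal.{u})
    (hτ : Cardinal.aleph0 ≤ τ) (S : Set G) (hS : IsWide τ S)
    (hG : Cardinal.mk G ≤ (2 : Cardinal.{u}) ^ ((2 : Cardinal.{u}) ^ τ)) :
    ∃ _ : TopologicalSpace G,
      IsTopologicalAddGroup G ∧ T2Space G ∧ IsPrecompactAddGroup G ∧ Dense S := by
  let ι := τ.ord.ToType
  have : Infinite ι := infinite_iff.2 (by rwa [mk_ord_toType])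
  obtain ⟨N, t, ht⟩ := exists_dense_seq_unitAddCircle_pow ι
  obtain ⟨s, hsS, hs⟩ := hS.exists_seq
    (fun α : ι => (mk_Iio_lt α (by simp [ι])).trans_eq (mk_ord_toType τ))
    (fun α => (N α + 1).factorial) fun α => Nat.factorial_pos _
  obtain ⟨χ, hχ, hχ0⟩ := exists_separating_characters_approx
    (by rwa [mk_set, mk_set, mk_ord_toType]) hs t
  refine exists_precompact_topology_of_injective (AddMonoidHom.pi χ)
    ((injective_iff_map_eq_zero _).2 fun g hg => hχ0 g fun i => congrFun hg i) ?_
  rw [dense_iff_inter_open]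
  rintro V hV ⟨y, hy⟩
  obtain ⟨J, U, hU, hJU⟩ := isOpen_pi_iff.1 hV y hy
  -- The radius allows for `2 / (n + 1)` between the characters at `s α` and `t α`, and for
  -- `1 / (n + 1)` between `t α` and `y`.
  obtain ⟨n, hn⟩ : ∃ n : ℕ, ∀ j ∈ J, Metric.closedBall (y j) (3 / (n + 1 : ℝ)) ⊆ U j := by
    have hlim : Filter.Tendsto (fun n : ℕ => 3 / (n + 1 : ℝ)) Filter.atTop (nhds 0) := by
      simpa [div_eq_mul_inv] using tendsto_one_div_add_atTop_nhds_zero_nat.const_mul (3 : ℝ)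
    refine Filter.Eventually.exists (f := Filter.atTop)
      ((Filter.eventually_all_finset J).2 fun j hj => ?_)
    obtain ⟨ε, hε, hball⟩ := Metric.isOpen_iff.1 (hU j hj).1 (y j) (hU j hj).2
    filter_upwards [hlim.eventually_lt_const hε] with n hn
    exact (Metric.closedBall_subset_ball hn).trans hball
  obtain ⟨α, rfl, hα⟩ := ht J y n
  refine ⟨_, hJU fun j hj => hn j hj ?_, mem_image_of_mem _ (hsS α)⟩
  rw [mem_closedBall_iff_norm]
  change ‖χ j (s α) - y j‖ ≤ _
  rw [← sub_add_sub_cancel _ (t α j)]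
  refine (norm_add_le _ _).trans ((add_le_add (hχ j α) (hα j hj)).trans_eq ?_)
  ring
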